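/- **Setting.** Let $N\ge 0$, $n=\lfloor N/2\rfloor$, $i'=N+1-i$, $\sigma\in S_N$, $v\in\mathbb C$. Let each of the contraction parameters $j_1,\dots,j_{N-1}$ take one of the three values $1$, $\iota_k$, $i$, where the $\iota_k$ are commuting nilpotent units, $\iota_k^2=0$. Put $(a,b)=\prod_{l=\min(a,b)}^{\max(a,b)-1}j_l$. Parameters with nilpotent values are kept as invertible formal parameters (the coefficients are Laurent series in them) until the value $j_k=\iota_k$ is substituted; the others are replaced by $1$ or $i$. A series is *regular* if it has no negative powers of the parameters; the *complex part* of its value at the nilpotent values is then its constant coefficient. A relation $x=0$ is *admissible* if, after division by some monomial in the parameters, all its coefficients are regular and its principal part (the part formed by the complex parts of the coefficients) is nonzero. A formula $\varepsilon(u_{ab})=x$, $\Delta(u_{ab})=x$ or $S(u_{ab})=x$ is admissible if all coefficients of $x$ are regular. **The quantum group.** Let $J$ be a product of distinct parameters $j_l$ and $q=e^{z}$, $z=Jv$. Let $\rho=(n-\frac12,\dots,\frac12,0,-\frac12,\dots,-n+\frac12)$ if $N=2n+1$ and $\rho=(n-1,\dots,1,0,0,-1,\dots,-n+1)$ if $N=2n$.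 Put $C_{ik}=q^{\rho_{i'}}\delta_{i'k}$ and $$R=\sum_{i\ne i'}\bigl(q\,e_{ii}\otimes e_{ii}+q^{-1}e_{ii}\otimes e_{i'i'}\bigr)+\sum_{i=i'}e_{ii}\otimes e_{ii}+\sum_{k\ne i,i'}e_{ii}\otimes e_{kk}+(q-q^{-1})\sum_{i>k}\bigl(e_{ik}\otimes e_{ki}-q^{\rho_i-\rho_k}e_{ik}\otimes e_{i'k'}\bigr).$$ Let $$D^{-1}=\tfrac1{\sqrt2}\begin{pmatrix}I&0&\tilde C_0\\0&\sqrt2&0\\i\tilde C_0&0&-iI\end{pmatrix}$$ (without the middle row and column if $N$ is even), where $\tilde C_0$ is the $n\times n$ matrix with units on the secondary diagonal and zeros elsewhere. Put $\tilde R=(D\otimes D)^{-1}R(D\otimes D)$ and $\tilde C=D^{-1}C(D^t)^{-1}$. The quantum orthogonal Cayley–Klein group $SO_v(N;j;\sigma)$ is the algebra of noncommutative polynomials in the $N^2$ variables $u_{ab}$ modulo the following relations for the matrix $U$ with $U_{ik}=(\sigma_i,\sigma_k)u_{\sigma_i\sigma_k}$, where $U_1=U\otimes I$ and $U_2=I\otimes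 U$: 1. $\tilde R\,U_1U_2=U_2U_1\tilde R$ (commutation relations); 2. $U\tilde CU^t=\tilde C$ and $U^t\tilde C^{-1}U=\tilde C^{-1}$ ($(v,j)$-orthogonality relations). Its counit, coproduct and antipode are given on the generators by 3. $\varepsilon(U)=I$, $\Delta(U)=U\dot\otimes U$ and $S(U)=\tilde CU^t\tilde C^{-1}$, where $(A\dot\otimes B)_{ik}=\sum_pA_{ip}\otimes B_{pk}$; dividing the $(i,k)$ entry by $(\sigma_i,\sigma_k)$ gives the formulas for $\varepsilon,\Delta,S$ of $u_{\sigma_i\sigma_k}$. The *commutation relations are defined* if there is a set of admissible relations which together with (2) generates the same two-sided ideal as (1) and (2). The contraction given by $j$ is *allowed* if the commutation relations are defined and all formulas (3) for the generators $u_{ab}$ and all relations (2) are admissible. **Theorem.** Let $J=\bigcup_{k=1}^n(\sigma_k,\sigma_{k'})$, the first-power product of all $j_l$ which occur in at least one $(\sigma_k,\sigma_{k'})$, $k=1,\dots,n$. Then for every choice of the values of $j_1,\dots,j_{N-1}$, in particular for nilpotent values of any or all of them, the formulas (3) for $\varepsilon(u_{ab})$, $\Delta(u_{ab})$ and $S(u_{ab})$,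 $a,b=1,\dots,N$, and all entries of the $(v,j)$-orthogonality relations (2) are admissible. Hence, if the commutation relations are defined, the contraction given by $j$ is allowed; thus all Cayley–Klein contractions of $SO_q(N)$ whose commutation relations are defined are allowed. -/

import Mathlib

open scoped TensorProduct Kronecker

noncomputable section

namespace CayleyKlein

/-! ### Contraction parameters -/

/-- The three values `1`, `ι_k`, `i` which a contraction parameter `j_k` may take. -/
inductive CKValue where
  | one
  | nilpotent
  | imaginary

/-- Laurent series over `ℂ` in the parameters `j_1, …, j_{N-1}` (index `l : Fin (N - 1)` stands
for `j_{l+1}`).  Only the parameters with a nilpotent value are kept as formal parameters; the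
others are replaced by `1` or `i`.  In this ring all `j_k` are invertible, so that expressions such
as `(σ_k, σ_{k'})⁻¹ sinh (J v ρ_k)` make sense before `j_k = ι_k` is substituted. -/
abbrev Coeff (N : ℕ) : Type := HahnSeries (Fin (N - 1) → ℤ) ℂ

/-- The exponent of the formal parameter in `j_l`. -/
def jExp {N : ℕ} (j : Fin (N - 1) → CKValue) (l : Fin (N - 1)) : Fin (N - 1) → ℤ :=
  match j l with
  | .one => 0
  | .nilpotent => Pi.single l 1
  | .imaginary => 0

/-- The numerical factor in `j_l`. -/
def jNum {N : ℕ} (j : Fin (N - 1) → CKValue) (l : Fin (N - 1)) : ℂ :=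
  match j l with
  | .one => 1
  | .nilpotent => 1
  | .imaginary => Complex.I

lemma jNum_ne_zero {N : ℕ} (j : Fin (N - 1) → CKValue) (l : Fin (N - 1)) : jNum j l ≠ 0 := by
  unfold jNum
  cases j l <;> simp

lemma jExp_nonneg {N : ℕ} (j : Fin (N - 1) → CKValue) (l : Fin (N - 1)) : 0 ≤ jExp j l := by
  unfold jExp
  cases j l <;> simp

/-- The Laurent monomial with exponent `m`. -/
def monomial {N : ℕ} (m : Fin (N - 1) → ℤ) : Coeff N := HahnSeries.single m 1

/-- The parameter `j_l`: equal to `1`, to `i`, or to the formal parameter number `l`. -/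
def jParam {N : ℕ} (j : Fin (N - 1) → CKValue) (l : Fin (N - 1)) : (Coeff N)ˣ where
  val := HahnSeries.single (jExp j l) (jNum j l)
  inv := HahnSeries.single (-jExp j l) (jNum j l)⁻¹
  val_inv := by
    rw [HahnSeries.single_mul_single, add_neg_cancel, mul_inv_cancel₀ (jNum_ne_zero j l)]; rfl
  inv_val := by
    rw [HahnSeries.single_mul_single, neg_add_cancel, inv_mul_cancel₀ (jNum_ne_zero j l)]; rfl

/-- The product of the parameters `j_l`, `l ∈ S`. -/
def jProd {N : ℕ} (j : Fin (N - 1) → CKValue) (S : Finset (Fin (N - 1))) : (Coeff N)ˣ :=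
  ∏ l ∈ S, jParam j l

lemma coe_jProd {N : ℕ} (j : Fin (N - 1) → CKValue) (S : Finset (Fin (N - 1))) :
    (jProd j S : Coeff N) = HahnSeries.single (∑ l ∈ S, jExp j l) (∏ l ∈ S, jNum j l) := by
  induction S using Finset.cons_induction with
  | empty => simp [jProd]
  | cons a s h ih =>
    have e : jProd j (Finset.cons a s h) = jParam j a * jProd j s := by
      simp only [jProd, Finset.prod_cons]
    rw [e, Units.val_mul, ih, Finset.sum_cons, Finset.prod_cons, ← HahnSeries.single_mul_single]
    rfl

/-- The indices of the parameters occurring in `(a, b) = ∏_{l = min (a, b)}^{max (a, b) - 1} j_l`. -/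
def between {N : ℕ} (a b : Fin N) : Finset (Fin (N - 1)) :=
  Finset.univ.filter fun l => min (a : ℕ) b ≤ (l : ℕ) ∧ (l : ℕ) < max (a : ℕ) b

/-- The Cayley–Klein multiplier `(a, b)`. -/
def ck {N : ℕ} (j : Fin (N - 1) → CKValue) (a b : Fin N) : (Coeff N)ˣ := jProd j (between a b)

/-- The indices of the parameters occurring in the union `⋃_{k=1}^n (σ_k, σ_{k'})`, where
`n = ⌊N/2⌋` and `k' = N + 1 - k`. -/
def unionIndices {N : ℕ} (σ : Equiv.Perm (Fin N)) : Finset (Fin (N - 1)) :=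
  (Finset.univ.filter fun k : Fin N => (k : ℕ) < N / 2).biUnion fun k =>
    between (σ k) (σ k.rev)

/-! ### The transformed deformation parameter

`J` is given by the set of the indices of its factors `j_l`. -/

lemma isPWO_multiples {N : ℕ} {m : Fin (N - 1) → ℤ} (hm : 0 ≤ m) :
    (Set.range fun n : ℕ => n • m).IsPWO := by
  rw [← Set.image_univ]
  exact (Set.IsPWO.image_of_monotone (Set.isWF_univ_iff.2 inferInstance).isPWO
    (fun a b h => nsmul_le_nsmul_left hm h))

/-- The series `exp (c · x)`, where `x` is the monomial with exponent `m ≥ 0`. -/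
def expMonomial {N : ℕ} (m : Fin (N - 1) → ℤ) (hm : 0 ≤ m) (c : ℂ) : Coeff N where
  coeff e := ∑' n : ℕ, if e = n • m then c ^ n / (n.factorial : ℂ) else 0
  isPWO_support' := by
    refine (isPWO_multiples hm).mono fun e he => ?_
    by_contra h
    refine he ?_
    have h' : ∀ n : ℕ, e ≠ n • m := fun n hn => h ⟨n, hn.symm⟩
    simp only [if_neg (h' _), tsum_zero]

/-- `q ^ w = exp (z w)` for `z = J v`. -/
def qPow {N : ℕ} (j : Fin (N - 1) → CKValue) (J : Finset (Fin (N - 1))) (v w : ℂ) : Coeff N :=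
  expMonomial (∑ l ∈ J, jExp j l) (Finset.sum_nonneg fun l _ => jExp_nonneg j l)
    ((∏ l ∈ J, jNum j l) * v * w)

/-! ### The matrices `ρ`, `C`, `D`, `R` -/

/-- `(ρ_1, …, ρ_N) = (n - 1/2, …, 1/2, 0, -1/2, …, -n + 1/2)` for `N = 2 n + 1` and
`(n - 1, …, 1, 0, 0, -1, …, -n + 1)` for `N = 2 n`. -/
def rho {N : ℕ} (k : Fin N) : ℂ :=
  if k < k.rev then (N : ℂ) / 2 - 1 - (k : ℕ)
  else if k.rev < k then -((N : ℂ) / 2 - 1 - (k.rev : ℕ))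
  else 0

/-- The matrix `D⁻¹ = 2^{-1/2} (I, 0, C̃₀; 0, √2, 0; i C̃₀, 0, -i I)` (without the middle row
and column for even `N`). -/
def dInv (N : ℕ) : Matrix (Fin N) (Fin N) ℂ := Matrix.of fun a b =>
  if a = a.rev then (if b = a then 1 else 0)
  else (1 / (Real.sqrt 2 : ℂ)) *
    (if a < a.rev then (if b = a then 1 else 0) + (if b = a.rev then 1 else 0)
    else (if b = a.rev then Complex.I else 0) - (if b = a then Complex.I else 0))

/-- The matrix `D = 2^{-1/2} (I, 0, -i C̃₀; 0, √2, 0; C̃₀, 0, i I)` (without the middle row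
and column for even `N`). -/
def dMat (N : ℕ) : Matrix (Fin N) (Fin N) ℂ := Matrix.of fun a b =>
  if a = a.rev then (if b = a then 1 else 0)
  else (1 / (Real.sqrt 2 : ℂ)) *
    (if a < a.rev then (if b = a then 1 else 0) - (if b = a.rev then Complex.I else 0)
    else (if b = a.rev then 1 else 0) + (if b = a then Complex.I else 0))

lemma dInv_mul_dMat (N : ℕ) : dInv N * dMat N = 1 := by
  ext a b
  have h2 : ((Real.sqrt 2 : ℂ))⁻¹ * ((Real.sqrt 2 : ℂ))⁻¹ = 1/2 := by
    rw [← mul_inv, ← Complex.ofReal_mul, Real.mul_self_sqrt (by norm_num)]; norm_num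
  rw [Matrix.mul_apply, Matrix.one_apply]
  simp only [dInv, Matrix.of_apply]
  rcases lt_trichotomy a a.rev with h | h | h
  · simp only [h.ne, h, if_true, if_false, mul_add, add_mul, Finset.sum_add_distrib, mul_ite,
      ite_mul, mul_one, mul_zero, zero_mul, Finset.sum_ite_eq', Finset.mem_univ]
    have h3 : a.rev ≠ a := h.ne'
    simp only [dMat, Matrix.of_apply, h.ne, h, h3, Fin.rev_rev,
      not_lt_of_gt h, if_false, if_true]
    by_cases e : b = a
    · subst e; simp [h.ne, ← two_mul]; rw [← mul_assoc, mul_assoc, h2]; norm_num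
    · by_cases e' : b = a.rev <;> simp [e, e', Ne.symm e, h3, h.ne]
  · rw [Finset.sum_eq_single a]
    · rw [if_pos h, if_pos rfl, dMat, Matrix.of_apply, if_pos h]; simp [eq_comm]
    · intro x _ hx; rw [if_pos h, if_neg hx, zero_mul]
    · simp
  · have h3 : a.rev ≠ a := h.ne
    simp only [h.ne', not_lt_of_gt h, if_false, mul_sub, sub_mul, Finset.sum_sub_distrib, mul_ite,
      ite_mul, mul_zero, zero_mul, Finset.sum_ite_eq',
      Finset.mem_univ, if_true]
    simp only [dMat, Matrix.of_apply, h.ne', h, h3, Fin.rev_rev,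
      not_lt_of_gt h, if_false, if_true]
    by_cases e : b = a
    · subst e; simp [h.ne']; linear_combination (-(2:ℂ)*Complex.I^2)*h2 - Complex.I_sq
    · by_cases e' : b = a.rev <;> simp [e, e', Ne.symm e, h3, h3.symm]

/-- A complex matrix with its entries regarded as constant series. -/
def constMat {N : ℕ} (A : Matrix (Fin N) (Fin N) ℂ) : Matrix (Fin N) (Fin N) (Coeff N) :=
  A.map fun c => HahnSeries.C c

section matrices

variable {N : ℕ} (j : Fin (N - 1) → CKValue) (J : Finset (Fin (N - 1))) (v : ℂ)

/-- `C_v(j)`, with entries `q ^ {ρ_{i'}} δ_{i' k}`, `q = exp (J v)`. -/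
def cMat : Matrix (Fin N) (Fin N) (Coeff N) := Matrix.of fun i k =>
  if i.rev = k then qPow j J v (rho i.rev) else 0

/-- `C_v(j)⁻¹`, with entries `q ^ {-ρ_i} δ_{i' k}`, `q = exp (J v)`. -/
def cMatInv : Matrix (Fin N) (Fin N) (Coeff N) := Matrix.of fun i k =>
  if i.rev = k then qPow j J v (-rho i) else 0

/-- `C̃_v(j) = D⁻¹ C_v(j) (Dᵗ)⁻¹`. -/
def cTilde : Matrix (Fin N) (Fin N) (Coeff N) :=
  constMat (dInv N) * cMat j J v * (constMat (dInv N)).transpose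

/-- `C̃_v(j)⁻¹ = Dᵗ C_v(j)⁻¹ D`. -/
def cTildeInv : Matrix (Fin N) (Fin N) (Coeff N) :=
  (constMat (dMat N)).transpose * cMatInv j J v * constMat (dMat N)

/-- The diagonal coefficients of `R_q`. -/
def rDiag (i k : Fin N) : Coeff N :=
  if i = k then (if i = i.rev then 1 else qPow j J v 1)
  else if k = i.rev then qPow j J v (-1)
  else 1

/-- The `R`-matrix of `SO_q(N)` in the symplectic basis, with `q = exp (J v)`:
`q ∑_{i ≠ i'} e_ii ⊗ e_ii + e_cc ⊗ e_cc + ∑_{i ≠ k, k'} e_ii ⊗ e_kk + q⁻¹ ∑_{i ≠ i'} e_ii ⊗ e_i'i'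
+ (q - q⁻¹) ∑_{i > k} (e_ik ⊗ e_ki - q^{ρ_i - ρ_k} e_ik ⊗ e_i'k')`, where the middle index `c = c'`
is present only for odd `N`. -/
def rMat : Matrix (Fin N × Fin N) (Fin N × Fin N) (Coeff N) :=
  (∑ i : Fin N, ∑ k : Fin N,
    rDiag j J v i k • (Matrix.single i i (1 : Coeff N) ⊗ₖ Matrix.single k k (1 : Coeff N))) +
  (qPow j J v 1 - qPow j J v (-1)) •
    ∑ i : Fin N, ∑ k ∈ Finset.univ.filter (fun k => k < i),
      (Matrix.single i k (1 : Coeff N) ⊗ₖ Matrix.single k i (1 : Coeff N) -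
        qPow j J v (rho i - rho k) •
          (Matrix.single i k (1 : Coeff N) ⊗ₖ Matrix.single i.rev k.rev (1 : Coeff N)))

/-- `R̃_v(j) = (D ⊗ D)⁻¹ R_v(j) (D ⊗ D)`. -/
def rTilde : Matrix (Fin N × Fin N) (Fin N × Fin N) (Coeff N) :=
  (constMat (dInv N) ⊗ₖ constMat (dInv N)) * rMat j J v *
    (constMat (dMat N) ⊗ₖ constMat (dMat N))

end matrices

/-! ### The quantum group `SO_v(N; j; σ)` -/

/-- Noncommutative polynomials in the `N²` variables `u_{ab}`. -/
abbrev Poly (N : ℕ) : Type := FreeAlgebra (Coeff N) (Fin N × Fin N)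

/-- The generator `u_{ab}`. -/
def u {N : ℕ} (a b : Fin N) : Poly N := FreeAlgebra.ι (Coeff N) (a, b)

/-- A matrix of coefficients as a matrix of noncommutative polynomials. -/
def scalarMat {N : ℕ} {ι : Type} (A : Matrix ι ι (Coeff N)) : Matrix ι ι (Poly N) :=
  A.map (algebraMap (Coeff N) (Poly N))

section quantumGroup

variable {N : ℕ} (σ : Equiv.Perm (Fin N)) (j : Fin (N - 1) → CKValue)
  (J : Finset (Fin (N - 1))) (v : ℂ)

/-- The generating matrix, `U(j; σ)_{ik} = (σ_i, σ_k) u_{σ_i σ_k}`. -/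
def uMat : Matrix (Fin N) (Fin N) (Poly N) := Matrix.of fun i k =>
  (ck j (σ i) (σ k) : Coeff N) • u (σ i) (σ k)

/-- `R̃_v(j) U_1 U_2 - U_2 U_1 R̃_v(j)`, with `U_1 = U ⊗ I`, `U_2 = I ⊗ U`. -/
def ruuRelation : Matrix (Fin N × Fin N) (Fin N × Fin N) (Poly N) :=
  scalarMat (rTilde j J v) * (uMat σ j ⊗ₖ (1 : Matrix (Fin N) (Fin N) (Poly N))) *
      ((1 : Matrix (Fin N) (Fin N) (Poly N)) ⊗ₖ uMat σ j) -
    ((1 : Matrix (Fin N) (Fin N) (Poly N)) ⊗ₖ uMat σ j) *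
      (uMat σ j ⊗ₖ (1 : Matrix (Fin N) (Fin N) (Poly N))) * scalarMat (rTilde j J v)

/-- `U C̃_v(j) Uᵗ - C̃_v(j)`. -/
def orthRelation₁ : Matrix (Fin N) (Fin N) (Poly N) :=
  uMat σ j * scalarMat (cTilde j J v) * (uMat σ j).transpose - scalarMat (cTilde j J v)

/-- `Uᵗ C̃_v(j)⁻¹ U - C̃_v(j)⁻¹`. -/
def orthRelation₂ : Matrix (Fin N) (Fin N) (Poly N) :=
  (uMat σ j).transpose * scalarMat (cTildeInv j J v) * uMat σ j - scalarMat (cTildeInv j J v)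

/-- The set of the `RUU` relations. -/
def ruuRelations : Set (Poly N) :=
  Set.range fun p : (Fin N × Fin N) × (Fin N × Fin N) => ruuRelation σ j J v p.1 p.2

/-- The set of the `(v, j)`-orthogonality relations. -/
def orthRelations : Set (Poly N) :=
  (Set.range fun p : Fin N × Fin N => orthRelation₁ σ j J v p.1 p.2) ∪
    Set.range fun p : Fin N × Fin N => orthRelation₂ σ j J v p.1 p.2

/-- The two-sided ideal of the relations of `SO_v(N; j; σ)`. -/
def definingIdeal : TwoSidedIdeal (Poly N) :=
  TwoSidedIdeal.span (ruuRelations σ j J v ∪ orthRelations σ j J v)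

/-- The quantum orthogonal Cayley–Klein group `SO_v(N; j; σ)`. -/
abbrev QuantumCKGroup : Type := (definingIdeal σ j J v).ringCon.Quotient

/-! The Hopf structure is given on the generators by `ε(U) = I`, `Δ(U) = U ⊗̇ U` and
`S(U) = C̃_v(j) Uᵗ C̃_v(j)⁻¹`, divided by the multipliers `(σ_i, σ_k)` of `U_{ik}`. -/

/-- The counit. -/
def counit : Poly N →ₐ[Coeff N] Coeff N :=
  FreeAlgebra.lift (Coeff N) fun p =>
    ((ck j p.1 p.2)⁻¹ : (Coeff N)ˣ) *
      (1 : Matrix (Fin N) (Fin N) (Coeff N)) (σ.symm p.1) (σ.symm p.2)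

/-- The coproduct. -/
def coproduct : Poly N →ₐ[Coeff N] Poly N ⊗[Coeff N] Poly N :=
  FreeAlgebra.lift (Coeff N) fun p =>
    (((ck j p.1 p.2)⁻¹ : (Coeff N)ˣ) : Coeff N) •
      ∑ r : Fin N, uMat σ j (σ.symm p.1) r ⊗ₜ[Coeff N] uMat σ j r (σ.symm p.2)

/-- The antipode, as an antihomomorphism. -/
def antipode : Poly N →ₐ[Coeff N] (Poly N)ᵐᵒᵖ :=
  FreeAlgebra.lift (Coeff N) fun p =>
    MulOpposite.op ((((ck j p.1 p.2)⁻¹ : (Coeff N)ˣ) : Coeff N) •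
      (scalarMat (cTilde j J v) * (uMat σ j).transpose * scalarMat (cTildeInv j J v))
        (σ.symm p.1) (σ.symm p.2))

lemma unit_smul_inv_smul {R M : Type} [CommRing R] [AddCommMonoid M] [Module R M] (c : Rˣ) (x : M) :
    (c : R) • ((c⁻¹ : Rˣ) : R) • x = x := by
  rw [smul_smul, Units.mul_inv, one_smul]

lemma counit_uMat (i k : Fin N) :
    counit σ j (uMat σ j i k) = (1 : Matrix (Fin N) (Fin N) (Coeff N)) i k := by
  have h : counit σ j (u (σ i) (σ k)) = ((ck j (σ i) (σ k))⁻¹ : (Coeff N)ˣ) *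
      (1 : Matrix (Fin N) (Fin N) (Coeff N)) (σ.symm (σ i)) (σ.symm (σ k)) :=
    FreeAlgebra.lift_ι_apply _ _
  have h' : uMat σ j i k = (ck j (σ i) (σ k) : Coeff N) • u (σ i) (σ k) := rfl
  rw [h', map_smul, h, smul_eq_mul, Units.mul_inv_cancel_left, σ.symm_apply_apply,
    σ.symm_apply_apply]

lemma coproduct_uMat (i k : Fin N) :
    coproduct σ j (uMat σ j i k) = ∑ r : Fin N, uMat σ j i r ⊗ₜ[Coeff N] uMat σ j r k := by
  have h : coproduct σ j (u (σ i) (σ k)) = (((ck j (σ i) (σ k))⁻¹ : (Coeff N)ˣ) : Coeff N) •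
      ∑ r : Fin N, uMat σ j (σ.symm (σ i)) r ⊗ₜ[Coeff N] uMat σ j r (σ.symm (σ k)) :=
    FreeAlgebra.lift_ι_apply _ _
  have h' : uMat σ j i k = (ck j (σ i) (σ k) : Coeff N) • u (σ i) (σ k) := rfl
  rw [h', map_smul, h, σ.symm_apply_apply, σ.symm_apply_apply]
  exact unit_smul_inv_smul _ _

lemma antipode_uMat (i k : Fin N) :
    (antipode σ j J v (uMat σ j i k)).unop =
      (scalarMat (cTilde j J v) * (uMat σ j).transpose * scalarMat (cTildeInv j J v)) i k := by
  have h : antipode σ j J v (u (σ i) (σ k)) =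
      MulOpposite.op ((((ck j (σ i) (σ k))⁻¹ : (Coeff N)ˣ) : Coeff N) •
        (scalarMat (cTilde j J v) * (uMat σ j).transpose * scalarMat (cTildeInv j J v))
          (σ.symm (σ i)) (σ.symm (σ k))) :=
    FreeAlgebra.lift_ι_apply _ _
  have h' : uMat σ j i k = (ck j (σ i) (σ k) : Coeff N) • u (σ i) (σ k) := rfl
  rw [h', map_smul, h, σ.symm_apply_apply, σ.symm_apply_apply]
  exact unit_smul_inv_smul _ _

end quantumGroup

/-! ### Admissibility -/

/-- The Pimenov algebra `D(ι)`: commuting generators `ι_1, …, ι_{N-1}` with `ι_k² = 0`. -/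
abbrev Pimenov (N : ℕ) : Type :=
  MvPolynomial (Fin (N - 1)) ℂ ⧸
    Ideal.span (Set.range fun l : Fin (N - 1) => (MvPolynomial.X l ^ 2 : MvPolynomial _ ℂ))

/-- The complex part of an element of the Pimenov algebra. -/
def complexPart (N : ℕ) : Pimenov N →+* ℂ :=
  Ideal.Quotient.lift _ (MvPolynomial.eval fun _ => (0 : ℂ)) (by
    intro a ha
    have h : Ideal.span (Set.range fun l : Fin (N - 1) =>
        (MvPolynomial.X l ^ 2 : MvPolynomial _ ℂ)) ≤
        RingHom.ker (MvPolynomial.eval fun _ : Fin (N - 1) => (0 : ℂ)) := by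
      rw [Ideal.span_le]
      rintro _ ⟨l, rfl⟩
      simp [RingHom.mem_ker]
    exact RingHom.mem_ker.1 (h ha))

/-- A series is regular if it has no negative powers of the parameters. -/
def IsRegularSeries {N : ℕ} (f : Coeff N) : Prop :=
  ∀ e : Fin (N - 1) → ℤ, f.coeff e ≠ 0 → 0 ≤ e

/-- The value of a regular series at the nilpotent values of the parameters: the square-free
monomials are the only ones that do not vanish. -/
def nilpotentValue {N : ℕ} (f : Coeff N) : Pimenov N :=
  Ideal.Quotient.mk _ (∑ S : Finset (Fin (N - 1)),
    MvPolynomial.C (f.coeff (∑ l ∈ S, Pi.single l 1)) * ∏ l ∈ S, MvPolynomial.X l)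

/-- The complex part of the nilpotent value is the constant coefficient. -/
lemma complexPart_nilpotentValue {N : ℕ} (f : Coeff N) :
    complexPart N (nilpotentValue f) = f.coeff 0 := by
  have h : complexPart N (nilpotentValue f) = MvPolynomial.eval (fun _ => (0 : ℂ))
      (∑ S : Finset (Fin (N - 1)), MvPolynomial.C (f.coeff (∑ l ∈ S, Pi.single l 1)) *
        ∏ l ∈ S, MvPolynomial.X l) := Ideal.Quotient.lift_mk _ _ _
  rw [h, map_sum, Finset.sum_eq_single ∅]
  · simp
  · intro S _ hS
    obtain ⟨l, hl⟩ := Finset.nonempty_iff_ne_empty.2 hS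
    simp [Finset.prod_eq_zero hl]
  · simp

section admissible

variable {N : ℕ} {ι M : Type} [AddCommMonoid M] [Module (Coeff N) M]
  (b : Module.Basis ι (Coeff N) M)

/-- All coefficients of `x` in the basis `b` are well defined for the nilpotent values of the
parameters. -/
def IsRegular (x : M) : Prop := ∀ w : ι, IsRegularSeries (b.repr x w)

/-- The principal (complex) part of a regular `x`, given by its coordinates in the basis `b`. -/
def principalPart (x : M) : ι →₀ ℂ :=
  (b.repr x).mapRange (fun f => complexPart N (nilpotentValue f)) (by
    simp [complexPart_nilpotentValue])

/-- The relation `x = 0` is admissible if, after division by a monomial in the parameters, it has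
no singular terms and has a nonzero principal part.  (The monomial is then unique: its exponent is
the least exponent occurring in `x`.) -/
def IsAdmissible (x : M) : Prop :=
  ∃ m : Fin (N - 1) → ℤ,
    IsRegular b (monomial (-m) • x) ∧ principalPart b (monomial (-m) • x) ≠ 0

end admissible

/-- The basis of the noncommutative polynomials formed by the words in the generators. -/
abbrev words (N : ℕ) :
    Module.Basis (FreeMonoid (Fin N × Fin N)) (Coeff N) (Poly N) :=
  FreeAlgebra.basisFreeMonoid (Coeff N) (Fin N × Fin N)

section contraction

variable {N : ℕ} (σ : Equiv.Perm (Fin N)) (j : Fin (N - 1) → CKValue)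
  (J : Finset (Fin (N - 1))) (v : ℂ)

/-! A formula `ε(u_{ab}) = x`, `Δ(u_{ab}) = x` or `S(u_{ab}) = x` is admissible if no term of its
right-hand side `x` is singular; its principal part then is the value of the contracted map. -/

/-- The formulas for the counit are admissible. -/
def CounitAdmissible : Prop := ∀ a b : Fin N, IsRegularSeries (counit σ j (u a b))

/-- The formulas for the coproduct are admissible. -/
def CoproductAdmissible : Prop :=
  ∀ a b : Fin N, IsRegular ((words N).tensorProduct (words N)) (coproduct σ j (u a b))

/-- The formulas for the antipode are admissible. -/
def AntipodeAdmissible : Prop :=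
  ∀ a b : Fin N, IsRegular (words N) (antipode σ j J v (u a b)).unop

/-- All `(v, j)`-orthogonality relations are admissible. -/
def OrthogonalityAdmissible : Prop :=
  ∀ i k : Fin N, IsAdmissible (words N) (orthRelation₁ σ j J v i k) ∧
    IsAdmissible (words N) (orthRelation₂ σ j J v i k)

/-- The commutation relations of the generators are defined: the overdetermined system of the `RUU`
relations can be replaced, in the presence of the `(v, j)`-orthogonality relations, by an
equivalent system `T` of admissible relations. -/
def CommutationRelationsDefined : Prop :=
  ∃ T : Set (Poly N), (∀ x ∈ T, IsAdmissible (words N) x) ∧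
    TwoSidedIdeal.span (T ∪ orthRelations σ j J v) = definingIdeal σ j J v

/-- The Cayley–Klein contraction of `SO_v(N; j; σ)` given by the values `j` is allowed: all
relations of the quantum group are admissible. -/
structure ContractionAllowed : Prop where
  commutation : CommutationRelationsDefined σ j J v
  counit : CounitAdmissible σ j
  coproduct : CoproductAdmissible σ j
  antipode : AntipodeAdmissible σ j J v
  orthogonality : OrthogonalityAdmissible σ j J v

end contraction

end CayleyKlein

end

/-!
The exponents `d(a, b)` of the Cayley–Klein multipliers `(a, b)` satisfy the triangle inequality
(`ckExp_triangle`): every parameter between `a` and `b` lies between `a` and `c` or between `c` and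
`b`.  Call a coefficient of order at least `d` if all its exponents are `≥ d` (`OrderGE`).

The matrices `C̃` and `C̃⁻¹` are supported on the two diagonals: `C̃_{aa} = cosh (J v ρ_a)` and
`C̃_{aa'} = ± i sinh (J v ρ_a)`.  As `J` contains every parameter in `(σ_a, σ_{a'})`, both matrices
are *adapted* (`IsAdapted`): the entry `(a, b)` has order at least `d(σ_a, σ_b)`.  So every term in
the formulas for `Δ`, `S` and in the entry `(i, k)` of the orthogonality relations is a
product of factors along a path of indices, and the triangle inequality bounds its order from
below by that of `(σ_i, σ_k)`.

For the relations it remains to find a coefficient whose order is exactly `d(σ_i, σ_k)`.  Adaptedness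
also demands that each row `a` has an entry `(a, b)` with `d(σ_a, σ_b) = 0` and nonzero constant
coefficient.  If `J` contains a formal parameter, the entry `(a, a)` with constant coefficient `1`
will do.  Otherwise `J` is a number, all `d(σ_a, σ_{a'})` vanish, and `cosh` and `sinh` have
no common zero.  With `a = i`, the word `u_{σ_i σ_i} u_{σ_k σ_b}` has the required coefficient.
-/

noncomputable section

namespace CayleyKlein

/-! ### Orders of series -/

/-- All exponents of the series `f` are at least `d`, componentwise. -/
def OrderGE {N : ℕ} (d : Fin (N - 1) → ℤ) (f : Coeff N) : Prop :=
  ∀ e : Fin (N - 1) → ℤ, f.coeff e ≠ 0 → d ≤ e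

namespace OrderGE

variable {N : ℕ} {d d' : Fin (N - 1) → ℤ} {f g : Coeff N}

lemma mono (hf : OrderGE d f) (h : d' ≤ d) : OrderGE d' f := fun e he => h.trans (hf e he)

lemma zero : OrderGE d (0 : Coeff N) := fun _ he => absurd rfl he

lemma add (hf : OrderGE d f) (hg : OrderGE d g) : OrderGE d (f + g) := fun e he => by
  by_cases h : f.coeff e = 0
  · exact hg e fun h' => he (by rw [HahnSeries.coeff_add, h, h', add_zero])
  · exact hf e h

lemma neg (hf : OrderGE d f) : OrderGE d (-f) := fun e he =>
  hf e fun h => he (by rw [HahnSeries.coeff_neg, h, neg_zero])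

lemma mul (hf : OrderGE d f) (hg : OrderGE d' g) : OrderGE (d + d') (f * g) := fun e he => by
  rw [HahnSeries.coeff_mul] at he
  obtain ⟨p, hp, -⟩ := Finset.exists_ne_zero_of_sum_ne_zero he
  rw [Finset.mem_antidiagonal] at hp
  rw [← hp.2.2]
  exact add_le_add (hf _ hp.1) (hg _ hp.2.1)

lemma single (d : Fin (N - 1) → ℤ) (c : ℂ) : OrderGE d (HahnSeries.single d c : Coeff N) :=
  fun e he => by
    by_contra h
    exact he (HahnSeries.coeff_single_of_ne fun h' => h h'.ge)

lemma const (c : ℂ) : OrderGE (0 : Fin (N - 1) → ℤ) (HahnSeries.C c) := single 0 c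

end OrderGE

section basis

variable {N : ℕ} {ι M : Type} [AddCommMonoid M] [Module (Coeff N) M]
  (b : Module.Basis ι (Coeff N) M) {d d' : Fin (N - 1) → ℤ}

/-- All coefficients of `x` in the basis `b` have order at least `d`. -/
def CoeffsGE (d : Fin (N - 1) → ℤ) (x : M) : Prop := ∀ w, OrderGE d (b.repr x w)

variable {b}

lemma CoeffsGE.add {x y : M} (hx : CoeffsGE b d x) (hy : CoeffsGE b d y) :
    CoeffsGE b d (x + y) := fun w => by
  rw [map_add, Finsupp.add_apply]
  exact (hx w).add (hy w)

lemma CoeffsGE.sum {κ : Type} {s : Finset κ} {x : κ → M} (h : ∀ i ∈ s, CoeffsGE b d (x i)) :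
    CoeffsGE b d (∑ i ∈ s, x i) := fun w => by
  rw [map_sum, Finsupp.finsetSum_apply]
  exact Finset.sum_induction _ (OrderGE d) (fun _ _ => OrderGE.add) OrderGE.zero
    fun i hi => h i hi w

lemma CoeffsGE.smul {x : M} {f : Coeff N} (hf : OrderGE d f) (hx : CoeffsGE b d' x) :
    CoeffsGE b (d + d') (f • x) := fun w => by
  rw [map_smul, Finsupp.smul_apply, smul_eq_mul]
  exact hf.mul (hx w)

lemma OrderGE.smul_basis {f : Coeff N} (hf : OrderGE d f) (w : ι) : CoeffsGE b d (f • b w) :=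
  fun w' => by
    classical
    rw [map_smul, b.repr_self, Finsupp.smul_single, smul_eq_mul, mul_one, Finsupp.single_apply]
    split_ifs
    exacts [hf, OrderGE.zero]

/-- The criterion of admissibility: the monomial with exponent `d` may be divided out if all
coefficients have order at least `d` and the exponent `d` does occur. -/
lemma IsAdmissible.of_coeffsGE {x : M} (hx : CoeffsGE b d x) (w : ι)
    (hw : (b.repr x w).coeff d ≠ 0) : IsAdmissible b x := by
  refine ⟨d, ?_, fun h => hw ?_⟩
  · have := CoeffsGE.smul (OrderGE.single (-d) 1) hx
    rw [neg_add_cancel] at this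
    exact this
  · have h' := DFunLike.congr_fun h w
    rw [principalPart, Finsupp.mapRange_apply, complexPart_nilpotentValue, map_smul,
      Finsupp.smul_apply, smul_eq_mul, monomial, Finsupp.zero_apply, ← add_neg_cancel d,
      HahnSeries.coeff_single_mul_add, one_mul] at h'
    exact h'

end basis

/-! ### Exponents of the Cayley–Klein multipliers -/

section multipliers

variable {N : ℕ} (j : Fin (N - 1) → CKValue)

/-- The exponent of the multiplier `(a, b)`. -/
def ckExp (a b : Fin N) : Fin (N - 1) → ℤ := ∑ l ∈ between a b, jExp j l

lemma sum_jExp_mono {S T : Finset (Fin (N - 1))} (h : S ⊆ T) :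
    ∑ l ∈ S, jExp j l ≤ ∑ l ∈ T, jExp j l :=
  Finset.sum_le_sum_of_subset_of_nonneg h fun l _ _ => jExp_nonneg j l

lemma between_comm (a b : Fin N) : between a b = between b a := by
  simp only [between, min_comm, max_comm]

lemma between_self (a : Fin N) : between a a = ∅ := by
  simp [between]

lemma between_subset_union (a b c : Fin N) : between a b ⊆ between a c ∪ between c b := by
  intro l
  simp only [between, Finset.mem_union, Finset.mem_filter, Finset.mem_univ, true_and]
  omega

lemma ckExp_comm (a b : Fin N) : ckExp j a b = ckExp j b a := by
  rw [ckExp, between_comm, ckExp]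

lemma ckExp_self (a : Fin N) : ckExp j a a = 0 := by
  rw [ckExp, between_self, Finset.sum_empty]

lemma ckExp_nonneg (a b : Fin N) : 0 ≤ ckExp j a b :=
  Finset.sum_nonneg fun l _ => jExp_nonneg j l

lemma ckExp_triangle (a b c : Fin N) : ckExp j a c ≤ ckExp j a b + ckExp j b c := by
  refine (sum_jExp_mono j (between_subset_union a c b)).trans ?_
  rw [ckExp, ckExp, ← Finset.sum_union_inter]
  exact le_add_of_nonneg_right (Finset.sum_nonneg fun l _ => jExp_nonneg j l)

lemma coe_ck (a b : Fin N) :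
    (ck j a b : Coeff N) = HahnSeries.single (ckExp j a b) (∏ l ∈ between a b, jNum j l) :=
  coe_jProd j _

lemma orderGE_ck (a b : Fin N) : OrderGE (ckExp j a b) (ck j a b : Coeff N) := by
  rw [coe_ck]
  exact OrderGE.single _ _

lemma orderGE_ck_inv (a b : Fin N) :
    OrderGE (-ckExp j a b) (((ck j a b)⁻¹ : (Coeff N)ˣ) : Coeff N) := by
  have h : (((ck j a b)⁻¹ : (Coeff N)ˣ) : Coeff N) =
      HahnSeries.single (-ckExp j a b) (∏ l ∈ between a b, jNum j l)⁻¹ := by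
    refine Units.inv_eq_of_mul_eq_one_right ?_
    rw [coe_ck, HahnSeries.single_mul_single, add_neg_cancel,
      mul_inv_cancel₀ (Finset.prod_ne_zero_iff.2 fun l _ => jNum_ne_zero j l)]
    rfl
  rw [h]
  exact OrderGE.single _ _

lemma between_rev_subset_unionIndices (σ : Equiv.Perm (Fin N)) (a : Fin N) :
    between (σ a) (σ a.rev) ⊆ unionIndices σ := by
  intro l hl
  rw [unionIndices, Finset.mem_biUnion]
  have ha := Fin.val_rev a
  rcases lt_trichotomy (a : ℕ) a.rev with h | h | h
  · exact ⟨a, by simp only [Finset.mem_filter, Finset.mem_univ, true_and]; omega, hl⟩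
  · rw [← Fin.ext h, between_self] at hl
    exact absurd hl (Finset.notMem_empty l)
  · refine ⟨a.rev, by simp only [Finset.mem_filter, Finset.mem_univ, true_and]; omega, ?_⟩
    rwa [Fin.rev_rev, between_comm]

end multipliers

/-! ### The powers of `q` -/

section exponential

variable {N : ℕ} {m : Fin (N - 1) → ℤ} (hm : 0 ≤ m)

lemma exists_of_coeff_expMonomial_ne_zero {c : ℂ} {e : Fin (N - 1) → ℤ}
    (h : (expMonomial m hm c).coeff e ≠ 0) : ∃ n : ℕ, e = n • m := by
  by_contra! h'
  refine h ?_
  simp only [expMonomial, if_neg (h' _), tsum_zero]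

lemma orderGE_expMonomial (c : ℂ) : OrderGE 0 (expMonomial m hm c) := fun e he => by
  obtain ⟨n, rfl⟩ := exists_of_coeff_expMonomial_ne_zero hm he
  exact nsmul_nonneg hm n

lemma coeff_expMonomial_zero_of_ne_zero (c : ℂ) (h : m ≠ 0) :
    (expMonomial m hm c).coeff 0 = 1 := by
  have h' : ∀ n : ℕ, n ≠ 0 → (0 : Fin (N - 1) → ℤ) ≠ n • m := fun n hn e =>
    h ((smul_eq_zero.1 e.symm).resolve_left hn)
  change ∑' n : ℕ, (if (0 : Fin (N - 1) → ℤ) = n • m then c ^ n / (n.factorial : ℂ) else 0) = 1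
  rw [tsum_eq_single 0 fun n hn => if_neg (h' n hn)]
  simp

lemma coeff_expMonomial_zero_of_eq_zero (c : ℂ) (h : m = 0) :
    (expMonomial m hm c).coeff 0 = Complex.exp c := by
  subst h
  change ∑' n : ℕ, (if (0 : Fin (N - 1) → ℤ) = n • (0 : Fin (N - 1) → ℤ) then
    c ^ n / (n.factorial : ℂ) else 0) = _
  simp only [smul_zero, if_true]
  rw [Complex.exp_eq_exp_ℂ, NormedSpace.exp_eq_tsum_div]

/-- Twice the hyperbolic sine of `c · x` is divisible by the monomial `x`. -/
lemma orderGE_expMonomial_sub (c c' : ℂ) :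
    OrderGE m (expMonomial m hm c - expMonomial m hm c') := fun e he => by
  by_cases h0 : e = 0
  · by_cases h : m = 0
    · rw [h, h0]
    · rw [h0, HahnSeries.coeff_sub, coeff_expMonomial_zero_of_ne_zero hm _ h,
        coeff_expMonomial_zero_of_ne_zero hm _ h, sub_self] at he
      exact absurd rfl he
  · have : ∃ n : ℕ, e = n • m := by
      by_cases h : (expMonomial m hm c).coeff e = 0
      · refine exists_of_coeff_expMonomial_ne_zero hm (c := c') fun h' => he ?_
        rw [HahnSeries.coeff_sub, h, h', sub_self]
      · exact exists_of_coeff_expMonomial_ne_zero hm h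
    obtain ⟨n, rfl⟩ := this
    have hn : n ≠ 0 := fun hn => h0 (by rw [hn, zero_smul])
    exact le_self_nsmul hm hn

end exponential

/-! ### The matrices `C̃` and `C̃⁻¹` -/

lemma rho_rev {N : ℕ} (k : Fin N) : rho k.rev = -rho k := by
  unfold rho
  rw [Fin.rev_rev]
  rcases lt_trichotomy k k.rev with h | h | h
  · rw [if_neg h.not_gt, if_pos h, if_pos h]
  · rw [if_neg h.not_gt, if_neg h.not_lt, if_neg h.not_lt, if_neg h.not_gt, neg_zero]
  · rw [if_pos h, if_neg h.not_gt, if_pos h, neg_neg]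

lemma inv_sqrt_two_mul_self : ((Real.sqrt 2 : ℂ))⁻¹ * ((Real.sqrt 2 : ℂ))⁻¹ = 1 / 2 := by
  rw [← mul_inv, ← Complex.ofReal_mul, Real.mul_self_sqrt (by norm_num)]
  norm_num

/-- The properties of `D⁻¹` and `Dᵗ` which determine, up to sign off the main diagonal, the result
of their action on a matrix with support on the secondary diagonal. -/
structure IsTwoDiagonal {N : ℕ} (g : Matrix (Fin N) (Fin N) ℂ) : Prop where
  eq_zero : ∀ a i, i ≠ a → i ≠ a.rev → g a i = 0
  mid : ∀ a, a = a.rev → g a a = 1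
  diag : ∀ a, a ≠ a.rev → g a a * g a a.rev = 1 / 2
  antidiag : ∀ a, a ≠ a.rev → g a a.rev * g a.rev a = -(g a a * g a.rev a.rev)

lemma isTwoDiagonal_dInv (N : ℕ) : IsTwoDiagonal (dInv N) where
  eq_zero a i h h' := by simp [dInv, h, h']
  mid a h := by simp [dInv, ← h]
  diag a h := by
    rcases lt_or_gt_of_ne h with h1 | h1
    · simp [dInv, h, h1, h.symm, inv_sqrt_two_mul_self]
    · simp [dInv, h, h1.not_gt, h.symm]
      linear_combination (-Complex.I ^ 2) * inv_sqrt_two_mul_self - Complex.I_sq / 2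
  antidiag a h := by
    rcases lt_or_gt_of_ne h with h1 | h1 <;> simp [dInv, h, h1, h1.not_gt, h.symm]

lemma isTwoDiagonal_dMat_transpose (N : ℕ) : IsTwoDiagonal (dMat N).transpose where
  eq_zero a i h h' := by
    have h2 : a ≠ i.rev := fun e => h' (by rw [e, Fin.rev_rev])
    simp [dMat, h.symm, h2]
  mid a h := by simp [dMat, ← h]
  diag a h := by
    rcases lt_or_gt_of_ne h with h1 | h1
    · simp [dMat, h, h1, h1.not_gt, h.symm, inv_sqrt_two_mul_self]
    · simp [dMat, h, h1, h1.not_gt, h.symm]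
      linear_combination (-Complex.I ^ 2) * inv_sqrt_two_mul_self - Complex.I_sq / 2
  antidiag a h := by
    rcases lt_or_gt_of_ne h with h1 | h1 <;> simp [dMat, h, h1, h1.not_gt, h.symm]

section adapted

variable {N : ℕ} (σ : Equiv.Perm (Fin N)) (j : Fin (N - 1) → CKValue)

/-- The entry `(a, b)` of `A` has at least the order of the multiplier `(σ_a, σ_b)`, and each row
has an entry of order exactly `0` at a place where this multiplier is a number. -/
structure IsAdapted (A : Matrix (Fin N) (Fin N) (Coeff N)) : Prop where
  orderGE : ∀ a b, OrderGE (ckExp j (σ a) (σ b)) (A a b)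
  exists_coeff_ne_zero : ∀ a, ∃ b, ckExp j (σ a) (σ b) = 0 ∧ (A a b).coeff 0 ≠ 0

/-- The matrix with entries `δ_{i' k} q^{ρ_{i'}}` becomes adapted under the action of a two-diagonal
matrix: its entries become `cosh` on the diagonal, multiples of `sinh` on the secondary diagonal. -/
lemma IsTwoDiagonal.isAdapted {g : Matrix (Fin N) (Fin N) ℂ} (hg : IsTwoDiagonal g) (v : ℂ)
    {A : Matrix (Fin N) (Fin N) (Coeff N)}
    (hA : ∀ a b, A a b = ∑ i, HahnSeries.C (g a i) * qPow j (unionIndices σ) v (rho i.rev) *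
      HahnSeries.C (g b i.rev)) : IsAdapted σ j A := by
  set J := unionIndices σ with hJ
  have entry_rev : ∀ a b, a ≠ a.rev → A a b =
      HahnSeries.C (g a a * g b a.rev) * qPow j J v (-rho a) +
      HahnSeries.C (g a a.rev * g b a) * qPow j J v (rho a) := by
    intro a b h
    rw [hA, Fintype.sum_eq_add a a.rev h fun i hi => by
      rw [hg.eq_zero a i hi.1 hi.2, map_zero, zero_mul, zero_mul]]
    rw [Fin.rev_rev, rho_rev, map_mul, map_mul]
    ring
  have entry_mid : ∀ a, a = a.rev → A a a = qPow j J v (rho a) := by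
    intro a h
    rw [hA, Fintype.sum_eq_single a fun i hi => by
      rw [hg.eq_zero a i hi (by rwa [← h]), map_zero, zero_mul, zero_mul], ← h, hg.mid a h]
    simp
  have entry_zero : ∀ a b, b ≠ a → b ≠ a.rev → A a b = 0 := by
    intro a b h h'
    rw [hA]
    refine Finset.sum_eq_zero fun i _ => ?_
    by_cases hi : i = a ∨ i = a.rev
    · have h1 : i.rev ≠ b ∧ i.rev ≠ b.rev := by
        rw [Ne, Ne, Fin.rev_inj]
        rcases hi with rfl | rfl
        · exact ⟨h'.symm, h.symm⟩
        · rw [Fin.rev_rev]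
          exact ⟨h.symm, h'.symm⟩
      rw [hg.eq_zero b _ h1.1 h1.2, map_zero, mul_zero]
    · rw [not_or] at hi
      rw [hg.eq_zero a i hi.1 hi.2, map_zero, zero_mul, zero_mul]
  have entry_diag : ∀ a, a ≠ a.rev → A a a =
      HahnSeries.C (1 / 2) * (qPow j J v (-rho a) + qPow j J v (rho a)) := by
    intro a h
    rw [entry_rev a a h, mul_comm (g a a.rev), hg.diag a h, mul_add]
  have entry_antidiag : ∀ a, a ≠ a.rev → A a a.rev =
      HahnSeries.C (g a a * g a.rev a.rev) * (qPow j J v (-rho a) - qPow j J v (rho a)) := by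
    intro a h
    rw [entry_rev a _ h, hg.antidiag a h, map_neg]
    ring
  refine ⟨fun a b => ?_, fun a => ?_⟩
  · by_cases hab : b = a
    · subst hab
      rw [ckExp_self]
      by_cases h : b = b.rev
      · rw [entry_mid b h]
        exact orderGE_expMonomial _ _
      · rw [entry_diag b h, ← add_zero (0 : Fin (N - 1) → ℤ)]
        exact (OrderGE.const _).mul ((orderGE_expMonomial _ _).add (orderGE_expMonomial _ _))
    · by_cases hab' : b = a.rev
      · subst hab'
        rw [entry_antidiag a (Ne.symm hab), ← zero_add (ckExp _ _ _)]
        exact (OrderGE.const _).mul ((orderGE_expMonomial_sub _ _ _).mono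
          (sum_jExp_mono j (between_rev_subset_unionIndices σ a)))
      · rw [entry_zero a b hab hab']
        exact OrderGE.zero
  · by_cases h : a = a.rev
    · refine ⟨a, ckExp_self j _, ?_⟩
      rw [entry_mid a h, qPow]
      by_cases hm : ∑ l ∈ J, jExp j l = 0
      · rw [coeff_expMonomial_zero_of_eq_zero _ _ hm]
        exact Complex.exp_ne_zero _
      · rw [coeff_expMonomial_zero_of_ne_zero _ _ hm]
        exact one_ne_zero
    · by_cases hm : ∑ l ∈ J, jExp j l = 0
      · by_cases hc : (A a a).coeff 0 = 0
        · refine ⟨a.rev, le_antisymm ?_ (ckExp_nonneg j _ _), fun hs => ?_⟩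
          · exact (sum_jExp_mono j (between_rev_subset_unionIndices σ a)).trans hm.le
          -- If both `cosh` and `sinh` vanish, so does the exponential function.
          have hga := hg.diag a h
          have hgr := hg.diag a.rev (by rw [Fin.rev_rev]; exact Ne.symm h)
          have hne : g a a * g a.rev a.rev ≠ 0 := by
            refine mul_ne_zero (fun e => ?_) fun e => ?_
            · rw [e] at hga; norm_num at hga
            · rw [e] at hgr; norm_num at hgr
          rw [entry_diag a h, HahnSeries.C_mul_eq_smul, HahnSeries.coeff_smul,
            HahnSeries.coeff_add, qPow, qPow, coeff_expMonomial_zero_of_eq_zero _ _ hm,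
            coeff_expMonomial_zero_of_eq_zero _ _ hm, smul_eq_mul] at hc
          rw [entry_antidiag a h, HahnSeries.C_mul_eq_smul, HahnSeries.coeff_smul,
            HahnSeries.coeff_sub, qPow, qPow, coeff_expMonomial_zero_of_eq_zero _ _ hm,
            coeff_expMonomial_zero_of_eq_zero _ _ hm, smul_eq_mul] at hs
          have hs' := (mul_eq_zero.1 hs).resolve_left hne
          exact Complex.exp_ne_zero ((∏ l ∈ J, jNum j l) * v * rho a)
            (by linear_combination hc - hs' / 2)
        · exact ⟨a, ckExp_self j _, hc⟩
      · refine ⟨a, ckExp_self j _, ?_⟩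
        rw [entry_diag a h, HahnSeries.C_mul_eq_smul, HahnSeries.coeff_smul,
          HahnSeries.coeff_add, qPow, qPow, coeff_expMonomial_zero_of_ne_zero _ _ hm,
          coeff_expMonomial_zero_of_ne_zero _ _ hm, smul_eq_mul]
        norm_num

lemma isAdapted_cTilde (v : ℂ) : IsAdapted σ j (cTilde j (unionIndices σ) v) := by
  refine (isTwoDiagonal_dInv N).isAdapted σ j v fun a b => ?_
  rw [cTilde, Matrix.mul_apply]
  simp only [Matrix.mul_apply, cMat, Matrix.of_apply, mul_ite, mul_zero, constMat,
    Matrix.transpose_apply, Matrix.map_apply, Finset.sum_mul, ite_mul, zero_mul]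
  rw [Finset.sum_comm]
  simp only [Finset.sum_ite_eq, Finset.mem_univ, if_true]

lemma isAdapted_cTildeInv (v : ℂ) : IsAdapted σ j (cTildeInv j (unionIndices σ) v) := by
  refine (isTwoDiagonal_dMat_transpose N).isAdapted σ j v fun a b => ?_
  rw [cTildeInv, Matrix.mul_apply]
  simp only [Matrix.mul_apply, cMatInv, Matrix.of_apply, mul_ite, mul_zero, constMat,
    Matrix.transpose_apply, Matrix.map_apply, Finset.sum_mul, ite_mul, zero_mul]
  rw [Finset.sum_comm]
  simp only [Finset.sum_ite_eq, Finset.mem_univ, if_true, rho_rev]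

end adapted

/-! ### The relations and the Hopf structure -/

section relations

variable {N : ℕ} {σ : Equiv.Perm (Fin N)} {j : Fin (N - 1) → CKValue}

lemma words_apply (w : FreeMonoid (Fin N × Fin N)) :
    words N w = FreeMonoid.lift (FreeAlgebra.ι (Coeff N)) w := by
  simp [FreeAlgebra.basisFreeMonoid, FreeAlgebra.equivMonoidAlgebraFreeMonoid]

lemma u_eq_words (a b : Fin N) : u a b = words N (FreeMonoid.of (a, b)) := by
  rw [words_apply, FreeMonoid.lift_eval_of, u]

lemma words_mul (w w' : FreeMonoid (Fin N × Fin N)) :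
    words N w * words N w' = words N (w * w') := by
  rw [words_apply, words_apply, words_apply, map_mul]

lemma words_one : words N 1 = 1 := by
  rw [words_apply, map_one]

lemma smul_mul_algebraMap_mul_smul {R A : Type} [CommSemiring R] [Semiring A] [Algebra R A]
    (x y z : R) (p q : A) :
    x • p * algebraMap R A y * z • q = (x * y * z) • (p * q) := by
  rw [← Algebra.commutes, ← Algebra.smul_def, smul_smul, smul_mul_smul_comm, mul_comm y]

lemma smul_algebraMap_mul_smul_mul_algebraMap {R A : Type} [CommSemiring R] [Semiring A]
    [Algebra R A] (x y z w : R) (p : A) :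
    x • (algebraMap R A y * z • p * algebraMap R A w) = (x * y * z * w) • p := by
  rw [← Algebra.commutes, ← Algebra.smul_def, ← Algebra.smul_def, smul_smul, smul_smul, smul_smul]
  congr 1
  ring

/-- If `A` is adapted, then the relation `W A Wᵗ = A` is admissible for every matrix `W` whose
entries `W_{ia}` are distinct generators with the multipliers `(σ_i, σ_a)`: the least exponent in
its entry `(i, k)` is that of `(σ_i, σ_k)`. -/
lemma IsAdapted.isAdmissible {A : Matrix (Fin N) (Fin N) (Coeff N)} (hA : IsAdapted σ j A)
    {f : Fin N → Fin N → Fin N × Fin N} (hf : ∀ i, Function.Injective (f i))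
    {W : Matrix (Fin N) (Fin N) (Poly N)}
    (hW : ∀ i a, W i a = (ck j (σ i) (σ a) : Coeff N) • words N (FreeMonoid.of (f i a)))
    (i k : Fin N) :
    IsAdmissible (words N) ((W * scalarMat A * W.transpose - scalarMat A) i k) := by
  have expand : (W * scalarMat A * W.transpose - scalarMat A) i k =
      ∑ b, ∑ a, ((ck j (σ i) (σ a) : Coeff N) * A a b * ck j (σ k) (σ b)) •
        words N (FreeMonoid.of (f i a) * FreeMonoid.of (f k b)) + (-A i k) • words N 1 := by
    rw [Matrix.sub_apply, Matrix.mul_apply, sub_eq_add_neg]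
    congr 1
    · refine Finset.sum_congr rfl fun b _ => ?_
      rw [Matrix.mul_apply, Finset.sum_mul]
      refine Finset.sum_congr rfl fun a _ => ?_
      rw [Matrix.transpose_apply, hW, hW, scalarMat, Matrix.map_apply, ← words_mul]
      exact smul_mul_algebraMap_mul_smul (R := Coeff N) (A := Poly N) _ _ _ _ _
    · rw [words_one, scalarMat, Matrix.map_apply]
      exact (congrArg Neg.neg (Algebra.algebraMap_eq_smul_one (A i k))).trans
        (neg_smul (A i k) (1 : Poly N)).symm
  obtain ⟨b₀, hb₀, hne⟩ := hA.exists_coeff_ne_zero i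
  rw [expand]
  refine IsAdmissible.of_coeffsGE (d := ckExp j (σ i) (σ k)) ?_
    (FreeMonoid.of (f i i) * FreeMonoid.of (f k b₀)) ?_
  · refine CoeffsGE.add (CoeffsGE.sum fun b _ => CoeffsGE.sum fun a _ => ?_) ?_
    · refine OrderGE.smul_basis ((((orderGE_ck j _ _).mul (hA.orderGE a b)).mul
        (orderGE_ck j _ _)).mono ?_) _
      rw [ckExp_comm j (σ k)]
      exact (ckExp_triangle j _ (σ b) _).trans (add_le_add_left (ckExp_triangle j _ _ _) _)
    · exact OrderGE.smul_basis (hA.orderGE i k).neg _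
  · have hword : ∀ a b, FreeMonoid.of (f i a) * FreeMonoid.of (f k b) =
        FreeMonoid.of (f i i) * FreeMonoid.of (f k b₀) ↔ a = i ∧ b = b₀ := by
      intro a b
      refine ⟨fun h => ?_, by rintro ⟨rfl, rfl⟩; rfl⟩
      have h' := congrArg FreeMonoid.toList h
      simp only [FreeMonoid.toList_mul, FreeMonoid.toList_of, List.cons_append, List.nil_append,
        List.cons.injEq, and_true] at h'
      exact ⟨hf i h'.1, hf k h'.2⟩
    have hone : (1 : FreeMonoid (Fin N × Fin N)) ≠
        FreeMonoid.of (f i i) * FreeMonoid.of (f k b₀) := fun h => by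
      have h' := congrArg FreeMonoid.length h
      simp at h'
    have hcoeff : (words N).repr (∑ b, ∑ a, ((ck j (σ i) (σ a) : Coeff N) * A a b *
          ck j (σ k) (σ b)) • words N (FreeMonoid.of (f i a) * FreeMonoid.of (f k b)) +
          (-A i k) • words N 1) (FreeMonoid.of (f i i) * FreeMonoid.of (f k b₀)) =
        (ck j (σ i) (σ i) : Coeff N) * A i b₀ * ck j (σ k) (σ b₀) := by
      classical
      simp only [map_add, map_sum, map_smul, Module.Basis.repr_self, Finsupp.add_apply,
        Finsupp.finsetSum_apply, Finsupp.smul_apply, Finsupp.single_apply, hword, hone,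
        if_false, add_zero, smul_eq_mul, mul_ite, mul_one, mul_zero, ite_and]
      simp
    -- As `d(σ_i, σ_{b₀}) = 0`, the multipliers `(σ_k, σ_{b₀})` and `(σ_k, σ_i)` have equal order.
    have hd : ckExp j (σ i) (σ k) = 0 + ckExp j (σ k) (σ b₀) := by
      rw [zero_add]
      refine le_antisymm ?_ ?_
      · have := ckExp_triangle j (σ i) (σ b₀) (σ k)
        rwa [hb₀, zero_add, ckExp_comm j (σ b₀)] at this
      · have := ckExp_triangle j (σ k) (σ i) (σ b₀)
        rwa [hb₀, add_zero, ckExp_comm j (σ k) (σ i)] at this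
    have hnum : ∀ S : Finset (Fin (N - 1)), ∏ l ∈ S, jNum j l ≠ 0 := fun S =>
      Finset.prod_ne_zero_iff.2 fun l _ => jNum_ne_zero j l
    rw [hcoeff, hd, coe_ck, coe_ck, HahnSeries.coeff_mul_single_add, ckExp_self,
      HahnSeries.coeff_single_zero_mul]
    exact mul_ne_zero (mul_ne_zero (hnum _) hne) (hnum _)

lemma uMat_eq_words (i k : Fin N) :
    uMat σ j i k = (ck j (σ i) (σ k) : Coeff N) • words N (FreeMonoid.of (σ i, σ k)) := by
  rw [← u_eq_words]
  rfl

lemma counitAdmissible (σ : Equiv.Perm (Fin N)) (j : Fin (N - 1) → CKValue) :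
    CounitAdmissible σ j := fun a b => by
  rw [counit, u, FreeAlgebra.lift_ι_apply, Matrix.one_apply]
  change OrderGE 0 _
  by_cases h : a = b
  · subst h
    rw [if_pos rfl, ← neg_zero, ← ckExp_self j a, mul_one]
    exact orderGE_ck_inv j a a
  · rw [if_neg (fun h' => h (σ.symm.injective h')), mul_zero]
    exact OrderGE.zero

lemma coproductAdmissible (σ : Equiv.Perm (Fin N)) (j : Fin (N - 1) → CKValue) :
    CoproductAdmissible σ j := fun a b => by
  have expand : coproduct σ j (u a b) = ∑ r,
      ((((ck j a b)⁻¹ : (Coeff N)ˣ) : Coeff N) * (ck j a (σ r) * ck j (σ r) b)) •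
        (words N).tensorProduct (words N) (FreeMonoid.of (a, σ r), FreeMonoid.of (σ r, b)) := by
    rw [coproduct, u, FreeAlgebra.lift_ι_apply]
    refine Finset.smul_sum.trans ?_
    refine Finset.sum_congr rfl fun r _ => ?_
    rw [uMat_eq_words, uMat_eq_words, TensorProduct.smul_tmul_smul,
      σ.apply_symm_apply, σ.apply_symm_apply, Module.Basis.tensorProduct_apply]
    exact smul_smul (M := Coeff N) (α := Poly N ⊗[Coeff N] Poly N) _ _ _
  rw [expand]
  refine CoeffsGE.sum (d := 0) fun r _ => ?_
  refine OrderGE.smul_basis (((orderGE_ck_inv j _ _).mul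
    ((orderGE_ck j _ _).mul (orderGE_ck j _ _))).mono ?_) _
  rw [neg_add_eq_sub, sub_nonneg]
  exact ckExp_triangle j _ _ _

lemma antipodeAdmissible (σ : Equiv.Perm (Fin N)) (j : Fin (N - 1) → CKValue) (v : ℂ) :
    AntipodeAdmissible σ j (unionIndices σ) v := fun a b => by
  have expand : (antipode σ j (unionIndices σ) v (u a b)).unop = ∑ r, ∑ p,
      ((((ck j a b)⁻¹ : (Coeff N)ˣ) : Coeff N) * cTilde j (unionIndices σ) v (σ.symm a) p *
        ck j (σ r) (σ p) * cTildeInv j (unionIndices σ) v r (σ.symm b)) •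
          words N (FreeMonoid.of (σ r, σ p)) := by
    rw [antipode, u, FreeAlgebra.lift_ι_apply, MulOpposite.unop_op, Matrix.mul_apply]
    refine (Finset.smul_sum (M := Coeff N) (N := Poly N)).trans ?_
    refine Finset.sum_congr rfl fun r _ => ?_
    rw [Matrix.mul_apply, Finset.sum_mul]
    refine (Finset.smul_sum (M := Coeff N) (N := Poly N)).trans ?_
    refine Finset.sum_congr rfl fun p _ => ?_
    rw [Matrix.transpose_apply, uMat_eq_words, scalarMat, scalarMat, Matrix.map_apply,
      Matrix.map_apply]
    exact smul_algebraMap_mul_smul_mul_algebraMap (R := Coeff N) (A := Poly N) _ _ _ _ _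
  rw [expand]
  refine CoeffsGE.sum (d := 0) fun r _ => CoeffsGE.sum fun p _ => ?_
  have h₁ := (isAdapted_cTilde σ j v).orderGE (σ.symm a) p
  have h₂ := (isAdapted_cTildeInv σ j v).orderGE r (σ.symm b)
  rw [σ.apply_symm_apply] at h₁ h₂
  refine OrderGE.smul_basis (((((orderGE_ck_inv j _ _).mul h₁).mul
    (orderGE_ck j _ _)).mul h₂).mono ?_) _
  have t₁ := ckExp_triangle j a (σ p) b
  have t₂ := ckExp_triangle j (σ p) (σ r) b
  rw [ckExp_comm j (σ p) (σ r)] at t₂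
  intro l
  have t₁' := t₁ l
  have t₂' := t₂ l
  simp only [Pi.add_apply, Pi.neg_apply, Pi.zero_apply] at t₁' t₂' ⊢
  linarith

lemma orthogonalityAdmissible (σ : Equiv.Perm (Fin N)) (j : Fin (N - 1) → CKValue) (v : ℂ) :
    OrthogonalityAdmissible σ j (unionIndices σ) v := fun i k => by
  refine ⟨(isAdapted_cTilde σ j v).isAdmissible (f := fun i a => (σ i, σ a))
    (fun i a b h => σ.injective (Prod.mk.inj h).2) uMat_eq_words i k, ?_⟩
  refine (isAdapted_cTildeInv σ j v).isAdmissible (f := fun i a => (σ a, σ i))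
    (W := (uMat σ j).transpose) (fun i a b h => σ.injective (Prod.mk.inj h).1)
    (fun i a => ?_) i k
  rw [Matrix.transpose_apply, uMat_eq_words, ck, between_comm, ck]

end relations

end CayleyKlein

end

theorem mainTheorem1 (N : ℕ) (σ : Equiv.Perm (Fin N)) (v : ℂ)
    (j : Fin (N - 1) → CayleyKlein.CKValue) (J : Finset (Fin (N - 1)))
    (hJ : J = CayleyKlein.unionIndices σ) :
    CayleyKlein.CounitAdmissible σ j ∧
    CayleyKlein.CoproductAdmissible σ j ∧
    CayleyKlein.AntipodeAdmissible σ j J v ∧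
    CayleyKlein.OrthogonalityAdmissible σ j J v ∧
    (CayleyKlein.CommutationRelationsDefined σ j J v →
      CayleyKlein.ContractionAllowed σ j J v) := by
  subst hJ
  have h₁ := CayleyKlein.counitAdmissible σ j
  have h₂ := CayleyKlein.coproductAdmissible σ j
  have h₃ := CayleyKlein.antipodeAdmissible σ j v
  have h₄ := CayleyKlein.orthogonalityAdmissible σ j v
  exact ⟨h₁, h₂, h₃, h₄, fun h => ⟨h, h₁, h₂, h₃, h₄⟩⟩
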